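/- **Theorem 5.3.** Let $\Omega$ be a compact metric space and $T:\Omega\to\Omega$ a homeomorphism which is *hyperbolic*: it has a dense orbit $\{T^n\omega : n\in\mathbb Z\}$, and there are $c,\lambda,\delta_0>0$ such that for all $x\in\Omega$ and $k\in\mathbb N$ with $d(x,T^kx)<\delta_0$ there are $q,y\in\Omega$ with $T^kq=q$ and, putting $\delta=c\,d(x,T^kx)$, for all $0\le j\le k$, $$d(T^jx,T^jq)\le\delta e^{-\lambda\min(j,k-j)},\qquad d(T^jq,T^jy)\le\delta e^{-\lambda j},\qquad d(T^jy,T^jx)\le\delta e^{-\lambda(k-j)}.$$ Let $\mathcal H$ be a proper unique visibility Gromov hyperbolic space, i.e. a proper metric space in which any two points are joined by a unique geodesic, all geodesic triangles are $\delta$-slim for some $\delta>0$, and any two complete geodesics $\mathbb R\to\mathcal H$ with the same end at $-\infty$ and the same end at $+\infty$ agree up to a translation of the parameter. Let $\partial\mathcal H$ be its Gromov boundary (geodesic rays up to bounded distance, with the usual topology, given by locally uniform convergence of generalized rays issuing from a base point), and assume that $\partial\mathcal H$ does not consist of exactly one point. Fix $p\in\mathcal H$. For $\xi\in\partial\mathcal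 H$ let $b_{p,\xi}(h)=\lim_n \big(d(x_n,h)-d(x_n,p)\big)$, for any sequence $x_n\to\xi$ in $\mathcal H$, be the Busemann function (the limit being the same along all such sequences). Let $A:\Omega\to \mathrm{Isom}(\mathcal H)$, let $A^n(\omega)=A(T^{n-1}\omega)\cdots A(\omega)$, and let $A^*(\omega):\partial\mathcal H\to\partial\mathcal H$ be the boundary map induced by $A(\omega)$. For a map $a$ from $\Omega$ to the self-maps of a topological space $X$, say that $(T,a)$ satisfies (P3) if there are continuous sections $s_{\omega_0,x_0}:\Omega\to X$, for $(\omega_0,x_0)\in\Omega\times X$, with $s_{\omega_0,x_0}(\omega_0)=x_0$ and $a(\omega)\cdot s_{\omega_0,x_0}(\omega)=s_{\omega_0,x_0}(T\omega)$ for all $\omega$, and such that $x_0\mapsto s_{\omega_0,x_0}(\omega)$ is continuous for all $\omega_0,\omega$. Let $\tau>0$ and suppose that - $(T,A)$ is $\tau$-Hölder: for every bounded $K\subset\mathcal H$ there is $C_K>0$ with $d(A(\omega_1)h,A(\omega_2)h)\le C_K\,d(\omega_1,\omega_2)^\tau$ for all $\omega_1,\omega_2\in\Omega$, $h\in K$;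 - (PPO): $A^n(\omega)=\mathrm{id}_{\mathcal H}$ whenever $T^n\omega=\omega$; - $(T,A^*)$ satisfies (P3) on $X=\partial\mathcal H$ with sections $\alpha=s_{\omega_0,\alpha_0}$ each of which is $\tau$-Hölder–Busemann: the functions $b_{p,\alpha(\omega)}$ are defined, and for every bounded $K\subset\mathcal H$ there is $D_K>0$ with $|b_{p,\alpha(\omega_1)}(h)-b_{p,\alpha(\omega_2)}(h)|\le D_K\,d(\omega_1,\omega_2)^\tau$ for all $\omega_1,\omega_2\in\Omega$, $h\in K$. Then: - (P3) $(T,A)$ satisfies (P3) on $X=\mathcal H$; - (P2) there is a pointwise continuous $G:\Omega\to \mathrm{Homeo}(\mathcal H)$ such that $\mathcal G(\omega,h)=(\omega,G(\omega)h)$ conjugates the skew product $F(\omega,h)=(T\omega,A(\omega)h)$ to the fibred identity: $(\mathcal G^{-1}\circ F\circ\mathcal G)(\omega,h)=(T\omega,h)$; - (P1) there is a pointwise continuous $B:\Omega\to\mathrm{Isom}(\mathcal H)$ with $B(T\omega)B(\omega)^{-1}=A(\omega)$ for all $\omega\in\Omega$. -/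

import Mathlib

open Filter Topology
open scoped NNReal

noncomputable section

namespace LivsicIsom

section Geometry

variable (H : Type*) [MetricSpace H]

/-! ### Geodesics and Gromov hyperbolicity -/

variable {H} in
/-- `γ` is a geodesic from `x` to `y`, parametrized by arc length on `[0, d(x, y)]`. -/
def IsGeodesicSegment (x y : H) (γ : Set.Icc (0 : ℝ) (dist x y) → H) : Prop :=
  Isometry γ ∧ γ ⟨0, le_rfl, dist_nonneg⟩ = x ∧ γ ⟨dist x y, dist_nonneg, le_rfl⟩ = y

/-- Every pair of points is joined by exactly one geodesic. -/
def IsUniqueGeodesicSpace : Prop :=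
  ∀ x y : H, ∃! γ : Set.Icc (0 : ℝ) (dist x y) → H, IsGeodesicSegment x y γ

variable {H} in
/-- The side `[x, y]`: the points lying on a geodesic from `x` to `y`. -/
def side (x y : H) : Set H :=
  {z | ∃ γ : Set.Icc (0 : ℝ) (dist x y) → H, IsGeodesicSegment x y γ ∧ z ∈ Set.range γ}

/-- There is `δ > 0` such that every geodesic triangle is `δ`-slim. -/
def HasSlimTriangles : Prop :=
  ∃ δ : ℝ, 0 < δ ∧ ∀ x y z : H, ∀ a ∈ side x y, ∃ b ∈ side y z ∪ side x z, dist a b ≤ δ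

/-! ### The Gromov boundary -/

/-- Geodesic rays: isometric maps `[0, ∞) → H`. -/
def GeodesicRay : Type _ := {γ : ℝ≥0 → H // Isometry γ}

/-- Two rays are equivalent when they stay at bounded distance. -/
instance rayEquiv : Setoid (GeodesicRay H) where
  r γ₁ γ₂ := ∃ K : ℝ, ∀ t : ℝ≥0, dist (γ₁.1 t) (γ₂.1 t) ≤ K
  iseqv :=
    { refl := fun γ => ⟨0, fun t => by simp⟩
      symm := fun ⟨K, hK⟩ => ⟨K, fun t => by rw [dist_comm]; exact hK t⟩
      trans := fun ⟨K, hK⟩ ⟨L, hL⟩ =>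
        ⟨K + L, fun t => (dist_triangle _ _ _).trans (add_le_add (hK t) (hL t))⟩ }

/-- The Gromov boundary: equivalence classes of geodesic rays. -/
def GromovBoundary : Type _ := Quotient (rayEquiv H)

variable {H}

/-- The boundary point `γ(+∞)` of a geodesic ray. -/
def GeodesicRay.endpoint (γ : GeodesicRay H) : GromovBoundary H := Quotient.mk _ γ

/-- The ray `t ↦ γ t`, `t ≥ 0`, of a complete geodesic `γ : ℝ → H`. -/
def posRay (γ : ℝ → H) (hγ : Isometry γ) : GeodesicRay H :=
  ⟨fun t => γ t, hγ.comp (Isometry.of_dist_eq fun _ _ => rfl)⟩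

/-- The ray `t ↦ γ (-t)`, `t ≥ 0`, of a complete geodesic `γ : ℝ → H`. -/
def negRay (γ : ℝ → H) (hγ : Isometry γ) : GeodesicRay H :=
  ⟨fun t => γ (-t), hγ.comp (Isometry.of_dist_eq fun a b => by
    rw [dist_neg_neg]; rfl)⟩

/-- The complete geodesic `γ` joins `β = γ(-∞)` to `α = γ(+∞)`. -/
def JoinsBoundary (γ : ℝ → H) (β α : GromovBoundary H) : Prop :=
  ∃ hγ : Isometry γ, (negRay γ hγ).endpoint = β ∧ (posRay γ hγ).endpoint = α

variable (H) in
/-- Proper unique visibility Gromov hyperbolic spaces: proper, uniquely geodesic, Gromov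
hyperbolic, and any two complete geodesics with the same ends agree up to a translation of the
parameter. -/
structure IsUniqueVisibilityGromovSpace : Prop where
  proper : ProperSpace H
  uniqueGeodesic : IsUniqueGeodesicSpace H
  slim : HasSlimTriangles H
  uniqueVisibility : ∀ (β α : GromovBoundary H) (γ₁ γ₂ : ℝ → H),
    JoinsBoundary γ₁ β α → JoinsBoundary γ₂ β α → ∃ c : ℝ, ∀ t, γ₂ t = γ₁ (t + c)

/-- `c` is a generalized geodesic ray with `c(∞) = x`, where `x` is a point of `H` or of the
boundary: either `c` is geodesic on some `[0, L]` and constant equal to `x` afterwards, or `c` is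
a geodesic ray in the class `x`. -/
def IsGeneralizedRayTo (c : ℝ≥0 → H) : H ⊕ GromovBoundary H → Prop
  | Sum.inl x => ∃ L : ℝ≥0, (∀ s ≤ L, ∀ t ≤ L, dist (c s) (c t) = dist s t) ∧ ∀ t ≥ L, c t = x
  | Sum.inr ξ => ∃ hc : Isometry c, GeodesicRay.endpoint ⟨c, hc⟩ = ξ

/-- Convergence of a sequence of `H ∪ ∂H`, seen from the base point `p`: there are generalized
rays from `p` to the `x n` such that every subsequence has a further subsequence converging,
uniformly on compact sets, to a generalized ray with endpoint `y`. -/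
def ConvergesFrom (p : H) (x : ℕ → H ⊕ GromovBoundary H) (y : H ⊕ GromovBoundary H) : Prop :=
  ∃ c : ℕ → ℝ≥0 → H, (∀ n, c n 0 = p ∧ IsGeneralizedRayTo (c n) (x n)) ∧
    ∀ φ : ℕ → ℕ, StrictMono φ → ∃ ψ : ℕ → ℕ, StrictMono ψ ∧ ∃ c' : ℝ≥0 → H,
      IsGeneralizedRayTo c' y ∧ TendstoLocallyUniformly (fun n => c (φ (ψ n))) c' atTop

/-- The topology of the boundary given by this convergence: a set is open when every sequence
of boundary points converging to one of its points is eventually in it. (For a proper Gromov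
hyperbolic space the convergence does not depend on the base point.) -/
instance : TopologicalSpace (GromovBoundary H) where
  IsOpen U := ∀ (p : H) (x : ℕ → GromovBoundary H), ∀ ξ ∈ U,
    ConvergesFrom p (fun n => Sum.inr (x n)) (Sum.inr ξ) → ∀ᶠ n in atTop, x n ∈ U
  isOpen_univ := fun _ _ _ _ _ => Eventually.of_forall fun _ => trivial
  isOpen_inter := fun _ _ hU hV p x ξ hξ hx => (hU p x ξ hξ.1 hx).and (hV p x ξ hξ.2 hx)
  isOpen_sUnion := fun _ hS p x ξ ⟨U, hU, hξ⟩ hx =>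
    (hS U hU p x ξ hξ hx).mono fun _ hn => ⟨U, hU, hn⟩

/-- The image of a geodesic ray under an isometry. -/
def mapRay (g : H ≃ᵢ H) (γ : GeodesicRay H) : GeodesicRay H :=
  ⟨fun t => g (γ.1 t), g.isometry.comp γ.2⟩

/-- The action `g*` of an isometry on the boundary, `g* [γ] = [g ∘ γ]`. -/
def boundaryMap (g : H ≃ᵢ H) : GromovBoundary H → GromovBoundary H :=
  Quotient.map (mapRay g) fun _ _ ⟨K, hK⟩ =>
    ⟨K, fun t => by simpa only [mapRay, g.isometry.dist_eq] using hK t⟩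

/-- `b` is the Busemann function `b_{p, ξ}` in the direction `ξ` with base point `p`:
`b h` is the limit of `d(x_n, h) - d(x_n, p)` along every sequence of `H` converging to `ξ`. -/
def IsBusemannFunction (p : H) (ξ : GromovBoundary H) (b : H → ℝ) : Prop :=
  ∀ (h : H) (x : ℕ → H), ConvergesFrom p (fun n => Sum.inl (x n)) (Sum.inr ξ) →
    Tendsto (fun n => dist (x n) h - dist (x n) p) atTop (𝓝 (b h))

end Geometry

section Cocycles

variable {Ω : Type*} [MetricSpace Ω] {H : Type*} [MetricSpace H]

/-! ### Hyperbolic base dynamics -/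

/-- The orbit segments of length `k` of `x` and `y` are exponentially `δ`-close with
exponent `lam`. -/
def ExponentiallyClose (T : Ω ≃ₜ Ω) (x y : Ω) (k : ℕ) (δ lam : ℝ) : Prop :=
  ∀ j : ℕ, j ≤ k → dist (T^[j] x) (T^[j] y) ≤ δ * Real.exp (-lam * (min j (k - j) : ℕ))

/-- The closing property. -/
def ClosingProperty (T : Ω ≃ₜ Ω) : Prop :=
  ∃ c lam δ₀ : ℝ, 0 < c ∧ 0 < lam ∧ 0 < δ₀ ∧ ∀ (x : Ω) (k : ℕ), dist x (T^[k] x) < δ₀ →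
    ∃ p : Ω, T^[k] p = p ∧ ExponentiallyClose T x p k (c * dist x (T^[k] x)) lam ∧
      ∃ y : Ω, ∀ j : ℕ, j ≤ k →
        dist (T^[j] p) (T^[j] y) ≤ c * dist x (T^[k] x) * Real.exp (-lam * j) ∧
        dist (T^[j] y) (T^[j] x) ≤ c * dist x (T^[k] x) * Real.exp (-lam * (k - j : ℕ))

/-- The homeomorphism `T` is hyperbolic: it has a dense orbit and the closing property. -/
def IsHyperbolic (T : Ω ≃ₜ Ω) : Prop :=
  (∃ ω : Ω, Dense (Set.range fun n : ℤ => (T ^ n) ω)) ∧ ClosingProperty T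

/-! ### Cocycles by isometries -/

/-- `A^n(ω) = A(T^{n-1} ω) ⋯ A(ω)`. -/
def cocycleIter (T : Ω ≃ₜ Ω) (A : Ω → H ≃ᵢ H) : ℕ → Ω → H ≃ᵢ H
  | 0, _ => 1
  | n + 1, ω => A (T^[n] ω) * cocycleIter T A n ω

/-- The periodic point obstruction. -/
def PPO (T : Ω ≃ₜ Ω) (A : Ω → H ≃ᵢ H) : Prop :=
  ∀ (ω : Ω) (n : ℕ), T^[n] ω = ω → cocycleIter T A n ω = 1

/-- `A` is `τ`-Hölder on bounded sets (in particular it is continuous for the topology of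
uniform convergence on bounded sets). -/
def IsHolderCocycle (τ : ℝ) (A : Ω → H ≃ᵢ H) : Prop :=
  ∀ K : Set H, Bornology.IsBounded K → ∃ C : ℝ, 0 < C ∧ ∀ ω₁ ω₂ : Ω, ∀ h ∈ K,
    dist (A ω₁ h) (A ω₂ h) ≤ C * dist ω₁ ω₂ ^ τ

/-- A section `α` of the boundary is `τ`-Hölder-Busemann: its Busemann functions
`b ω = b_{p, α ω}` are `τ`-Hölder in `ω`, uniformly on bounded sets. -/
def IsHolderBusemann (p : H) (τ : ℝ) (α : Ω → GromovBoundary H) : Prop :=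
  ∃ b : Ω → H → ℝ, (∀ ω, IsBusemannFunction p (α ω) (b ω)) ∧
    ∀ K : Set H, Bornology.IsBounded K → ∃ D : ℝ, 0 < D ∧ ∀ ω₁ ω₂ : Ω, ∀ h ∈ K,
      |b ω₁ h - b ω₂ h| ≤ D * dist ω₁ ω₂ ^ τ

/-! ### The three problems -/

/-- `s` is a continuous invariant section through `(ω₀, x₀)`, for a cocycle of maps `act ω`
of a topological space `X`. -/
structure IsContinuousInvariantSection {X : Type*} [TopologicalSpace X] (T : Ω ≃ₜ Ω)
    (act : Ω → X → X) (ω₀ : Ω) (x₀ : X) (s : Ω → X) : Prop where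
  continuous : Continuous s
  passes : s ω₀ = x₀
  invariant : ∀ ω, act ω (s ω) = s (T ω)

/-- The family `s ω₀ x₀` of sections solves problem (P3). -/
structure SolvesP3 {X : Type*} [TopologicalSpace X] (T : Ω ≃ₜ Ω) (act : Ω → X → X)
    (s : Ω → X → Ω → X) : Prop where
  isSection : ∀ ω₀ x₀, IsContinuousInvariantSection T act ω₀ x₀ (s ω₀ x₀)
  continuous_point : ∀ ω₀ ω, Continuous fun x₀ => s ω₀ x₀ ω

/-- (P1): the cohomological equation has a pointwise continuous solution in `Isom(H)`. -/
def P1 (T : Ω ≃ₜ Ω) (A : Ω → H ≃ᵢ H) : Prop :=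
  ∃ B : Ω → H ≃ᵢ H, (∀ h, Continuous fun ω => B ω h) ∧ ∀ ω, B (T ω) * (B ω)⁻¹ = A ω

/-- The skew product `F(ω, h) = (T ω, A(ω) h)`. -/
def skewProduct (T : Ω ≃ₜ Ω) (A : Ω → H ≃ᵢ H) (q : Ω × H) : Ω × H := (T q.1, A q.1 q.2)

/-- The fibred identity `(ω, h) ↦ (T ω, h)`. -/
def fibredIdentity (T : Ω ≃ₜ Ω) (q : Ω × H) : Ω × H := (T q.1, q.2)

/-- The bijection `(ω, h) ↦ (ω, G(ω) h)`. -/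
def fibrePreserving (G : Ω → H ≃ₜ H) : Ω × H ≃ Ω × H :=
  Equiv.prodShear (Equiv.refl Ω) fun ω => (G ω).toEquiv

/-- (P2): the skew product is conjugate to the fibred identity through a pointwise continuous
family of homeomorphisms of the fibre. -/
def P2 (T : Ω ≃ₜ Ω) (A : Ω → H ≃ᵢ H) : Prop :=
  ∃ G : Ω → H ≃ₜ H, (∀ h, Continuous fun ω => G ω h) ∧
    (fibrePreserving G).symm ∘ skewProduct T A ∘ fibrePreserving G = fibredIdentity T

/-- (P3) for the cocycle by isometries. -/
def P3 (T : Ω ≃ₜ Ω) (A : Ω → H ≃ᵢ H) : Prop :=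
  ∃ s : Ω → H → Ω → H, SolvesP3 T (fun ω h => A ω h) s

end Cocycles

end LivsicIsom

end

open LivsicIsom

/-!
A pointwise continuous solution `B` of the cohomological equation gives the other two conclusions
at once: `G = B`, and the sections `ω ↦ B(ω) B(ω₀)⁻¹ h₀`. To find `B`, follow the cocycle along a
dense orbit `x_m = T^m ω₀`, `m ∈ ℤ`, as isometries `B_m`. When `x_m` is close to `x_n`, the closing
property compares the orbit segment between them with a periodic one, on which the cocycle is
trivial. As `A` is Hölder, the errors are dominated by a geometric series, so `B_m h` is close to
`B_n h`; hence `B` extends continuously to `Ω`. The Hölder constant depends on the bounded set in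
which the points move, so this works once the `B_m p` are known to be bounded
(`orbitCocycle_uniform`, `P1_of_bounded`).

Boundedness comes from the boundary (`exists_bound_orbitCocycle`). For an invariant section `α`,
the transformation rule of Busemann functions (`IsBusemannFunction.map_isometryEquiv`) writes
`b_{p, α(x_m)}(B_m p)` as a Birkhoff sum of the Hölder function
`ω ↦ -b_{p, α(ω)}(A(ω)⁻¹ p)`, whose sums over periodic orbits vanish; the scalar version of the
argument above bounds it (`exists_bound_busemann`). Thus `B_m p` lies in horoballs of bounded
size centred at `α(x_m)` and `β(x_m)`, for any two sections. Horoballs with distinct centres have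
bounded intersection (`IsBusemannFunction.bounded_inter`), and since Busemann functions are
quasi-convex, the bound is uniform for `ω` near a point where `α` and `β` differ
(`exists_nhds_bounded_inter`). Every point of `Ω` has such a pair of sections, and `Ω` is compact.
If the boundary is empty, then `H` is bounded, since geodesics of unbounded length from a point
subconverge to a ray.
-/

namespace LivsicIsom

/-! ### Geodesics and rays -/

section Geometry

variable {H : Type*} [MetricSpace H]

theorem dist_add_dist_of_mem_side {x y z : H} (hz : z ∈ side x y) :
    dist x z + dist z y = dist x y := by
  obtain ⟨γ, ⟨hiso, h0, h1⟩, ⟨r, hr⟩, rfl⟩ := hz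
  have e0 := hiso.dist_eq ⟨0, le_rfl, dist_nonneg⟩ ⟨r, hr⟩
  have e1 := hiso.dist_eq ⟨r, hr⟩ ⟨dist x y, dist_nonneg, le_rfl⟩
  rw [h0, Subtype.dist_eq, Real.dist_eq, abs_of_nonpos (by simpa using hr.1)] at e0
  rw [h1, Subtype.dist_eq, Real.dist_eq, abs_of_nonpos (by simpa using hr.2)] at e1
  rw [e0, e1]
  ring

theorem mem_side_symm {x y z : H} (hz : z ∈ side x y) : z ∈ side y x := by
  obtain ⟨γ, ⟨hiso, h0, h1⟩, ⟨r, hr⟩, rfl⟩ := hz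
  refine ⟨fun t => γ ⟨dist x y - t.1, ?_, ?_⟩, ⟨?_, ?_, ?_⟩, ⟨dist x y - r, ?_, ?_⟩, ?_⟩
  · linarith [t.2.2, dist_comm x y]
  · linarith [t.2.1]
  · refine Isometry.of_dist_eq fun a b => ?_
    rw [hiso.dist_eq, Subtype.dist_eq, Subtype.dist_eq, dist_sub_left]
  · simpa using h1
  · simpa [dist_comm y x] using h0
  · linarith [hr.2]
  · rw [dist_comm y x]
    linarith [hr.1]
  · simp

theorem IsUniqueGeodesicSpace.eq_of_mem_side (hU : IsUniqueGeodesicSpace H) {x y z w : H}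
    (hz : z ∈ side x y) (hw : w ∈ side x y) (h : dist x z = dist x w) : z = w := by
  obtain ⟨γ, hγ, ⟨r, hr⟩, rfl⟩ := hz
  obtain ⟨γ', hγ', ⟨r', hr'⟩, rfl⟩ := hw
  obtain rfl := (hU x y).unique hγ hγ'
  have e0 := hγ.1.dist_eq ⟨0, le_rfl, dist_nonneg⟩ ⟨r, hr⟩
  have e1 := hγ.1.dist_eq ⟨0, le_rfl, dist_nonneg⟩ ⟨r', hr'⟩
  rw [hγ.2.1, Subtype.dist_eq, Real.dist_eq, abs_of_nonpos (by simpa using hr.1)] at e0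
  rw [hγ.2.1, Subtype.dist_eq, Real.dist_eq, abs_of_nonpos (by simpa using hr'.1)] at e1
  have : r = r' := by
    simp only at e0 e1
    linarith
  subst this
  rfl

/-- `g` runs along a geodesic from `x` to `y` at unit speed and then stays at `y`. -/
structure IsStoppedGeodesic (x y : H) (g : ℝ≥0 → H) : Prop where
  dist_eq : ∀ s ≤ nndist x y, ∀ t ≤ nndist x y, dist (g s) (g t) = dist s t
  dist_le : ∀ s t, dist (g s) (g t) ≤ dist s t
  map_zero : g 0 = x
  eq_of_le : ∀ t ≥ nndist x y, g t = y
  mem_side : ∀ t, g t ∈ side x y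

theorem IsStoppedGeodesic.dist_left {x y : H} {g : ℝ≥0 → H} (hg : IsStoppedGeodesic x y g)
    {t : ℝ≥0} (ht : t ≤ nndist x y) : dist x (g t) = t := by
  rw [← hg.map_zero, hg.dist_eq 0 zero_le t ht, NNReal.dist_eq]
  simp

theorem IsUniqueGeodesicSpace.exists_isStoppedGeodesic (hU : IsUniqueGeodesicSpace H) (x y : H) :
    ∃ g : ℝ≥0 → H, IsStoppedGeodesic x y g := by
  obtain ⟨γ, ⟨hiso, h0, h1⟩, -⟩ := hU x y
  refine ⟨fun t => γ ⟨min t (dist x y), le_min t.2 dist_nonneg, min_le_right _ _⟩,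
    ⟨?_, ?_, ?_, ?_, ?_⟩⟩
  · intro s hs t ht
    have hs' : (s : ℝ) ≤ dist x y := by exact_mod_cast hs
    have ht' : (t : ℝ) ≤ dist x y := by exact_mod_cast ht
    rw [hiso.dist_eq, Subtype.dist_eq, NNReal.dist_eq, Real.dist_eq]
    simp only [min_eq_left hs', min_eq_left ht']
  · intro s t
    rw [hiso.dist_eq, Subtype.dist_eq, NNReal.dist_eq, Real.dist_eq]
    simpa using abs_min_sub_min_le_max (s : ℝ) (dist x y) t (dist x y)
  · convert h0 using 3
    simp
  · intro t ht
    have ht' : dist x y ≤ t := by exact_mod_cast ht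
    convert h1 using 3
    simp [ht']
  · exact fun t => ⟨γ, ⟨hiso, h0, h1⟩, Set.mem_range_self _⟩

theorem dist_zero_of_isometry {γ : ℝ≥0 → H} (hγ : Isometry γ) (s : ℝ≥0) :
    dist (γ 0) (γ s) = s := by
  rw [hγ.dist_eq, NNReal.dist_eq]
  simp

theorem mem_side_of_isometry {γ : ℝ≥0 → H} (hγ : Isometry γ) {u s : ℝ≥0} (hu : u ≤ s) :
    γ u ∈ side (γ 0) (γ s) := by
  have hd := dist_zero_of_isometry hγ s
  refine ⟨fun r => γ ⟨r.1, r.2.1⟩, ⟨?_, rfl, ?_⟩, ⟨u, u.2, ?_⟩, rfl⟩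
  · exact hγ.comp (Isometry.of_dist_eq fun _ _ => rfl)
  · exact congrArg γ (NNReal.eq hd)
  · rw [hd]
    exact_mod_cast hu

theorem IsUniqueGeodesicSpace.exists_eq_of_mem_side (hU : IsUniqueGeodesicSpace H)
    {γ : ℝ≥0 → H} (hγ : Isometry γ) {s : ℝ≥0} {w : H} (hw : w ∈ side (γ 0) (γ s)) :
    ∃ u, w = γ u := by
  have h := dist_add_dist_of_mem_side hw
  rw [dist_zero_of_isometry hγ s] at h
  have hle : nndist (γ 0) w ≤ s := by
    rw [← NNReal.coe_le_coe, coe_nndist]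
    linarith [dist_nonneg (x := w) (y := γ s)]
  refine ⟨nndist (γ 0) w, hU.eq_of_mem_side hw (mem_side_of_isometry hγ hle) ?_⟩
  rw [dist_zero_of_isometry hγ, coe_nndist]

/-! ### Limits of geodesics -/

/-- A form of the Arzelà–Ascoli theorem for `1`-Lipschitz maps with a common starting point. -/
theorem exists_subseq_tendstoLocallyUniformly [ProperSpace H] (p : H) (g : ℕ → ℝ≥0 → H)
    (hg : ∀ n s t, dist (g n s) (g n t) ≤ dist s t) (h0 : ∀ n, g n 0 = p) :
    ∃ ψ : ℕ → ℕ, StrictMono ψ ∧ ∃ c : ℝ≥0 → H,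
      TendstoLocallyUniformly (fun n => g (ψ n)) c atTop := by
  -- The limit is taken pointwise along an ultrafilter; the Lipschitz bound makes it uniform.
  let U : Ultrafilter ℕ := hyperfilter ℕ
  have hlim : ∀ t, ∃ y, Tendsto (fun n => g n t) U (𝓝 y) := by
    intro t
    have hmem : ∀ n, g n t ∈ Metric.closedBall p t := by
      intro n
      have := hg n t 0
      rw [h0, NNReal.dist_eq] at this
      simpa using this
    obtain ⟨y, -, hy⟩ := (isCompact_closedBall p (t : ℝ)).ultrafilter_le_nhds
      (U.map fun n => g n t) (by
        rw [le_principal_iff]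
        exact Filter.mem_map.2 (Filter.univ_mem' hmem))
    exact ⟨y, hy⟩
  choose c hc using hlim
  have hcl : ∀ s t, dist (c s) (c t) ≤ dist s t := fun s t =>
    le_of_tendsto ((hc s).dist (hc t)) (Eventually.of_forall fun n => hg n s t)
  have hev : ∀ k : ℕ, ∃ᶠ n in atTop, ∀ j ∈ Finset.range ((k + 1) ^ 2 + 1),
      dist (g n ((j : ℝ≥0) / (k + 1))) (c ((j : ℝ≥0) / (k + 1))) < 1 / ((k : ℝ) + 1) := by
    intro k
    have h1 : ∀ᶠ n in (U : Filter ℕ), ∀ j ∈ Finset.range ((k + 1) ^ 2 + 1),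
        dist (g n ((j : ℝ≥0) / (k + 1))) (c ((j : ℝ≥0) / (k + 1))) < 1 / ((k : ℝ) + 1) := by
      rw [Filter.eventually_all_finset]
      intro j _
      exact Metric.tendsto_nhds.1 (hc _) _ (by positivity)
    exact h1.frequently.filter_mono Nat.hyperfilter_le_atTop
  obtain ⟨ψ, hψ, hψd⟩ := extraction_forall_of_frequently hev
  refine ⟨ψ, hψ, c, Metric.tendstoLocallyUniformly_iff.2 fun ε hε x => ?_⟩
  refine ⟨Set.Iio (x + 1), Iio_mem_nhds (by simp), ?_⟩
  obtain ⟨N, hN⟩ := exists_nat_gt (max (x : ℝ) (3 / ε))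
  filter_upwards [eventually_ge_atTop N] with k hk y hy
  have hkN : (N : ℝ) ≤ k := by exact_mod_cast hk
  have hk1 : (x : ℝ) ≤ k := ((le_max_left _ _).trans hN.le).trans hkN
  have hk2 : 3 / ε < (k : ℝ) + 1 := by
    have := ((le_max_right (x : ℝ) (3 / ε)).trans_lt hN).trans_le hkN
    linarith
  have hkpos : (0 : ℝ) < (k : ℝ) + 1 := by positivity
  have hy' : (y : ℝ) < x + 1 := by exact_mod_cast hy
  set j : ℕ := ⌊(y : ℝ) * (k + 1)⌋₊ with hj
  have hj1 : (j : ℝ) ≤ y * (k + 1) := Nat.floor_le (by positivity)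
  have hj2 : (y : ℝ) * (k + 1) < j + 1 := Nat.lt_floor_add_one _
  have hjr : j ∈ Finset.range ((k + 1) ^ 2 + 1) := by
    rw [Finset.mem_range, Nat.lt_succ_iff]
    have : (j : ℝ) ≤ ((k : ℝ) + 1) ^ 2 := by
      refine hj1.trans ?_
      rw [sq]
      gcongr
      linarith
    exact_mod_cast this
  have hd := hψd k j hjr
  set z : ℝ≥0 := (j : ℝ≥0) / (k + 1) with hz
  have hyz : dist y z ≤ 1 / ((k : ℝ) + 1) := by
    rw [NNReal.dist_eq, hz]
    push_cast
    have e : (y : ℝ) - j / (k + 1) = (y * (k + 1) - j) / (k + 1) := by field_simp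
    rw [e, abs_of_nonneg (by apply div_nonneg <;> linarith)]
    gcongr
    linarith
  calc dist (c y) (g (ψ k) y)
      ≤ dist (c y) (c z) + dist (c z) (g (ψ k) z) + dist (g (ψ k) z) (g (ψ k) y) :=
        dist_triangle4 _ _ _ _
    _ < 1 / ((k : ℝ) + 1) + 1 / ((k : ℝ) + 1) + 1 / ((k : ℝ) + 1) := by
        rw [dist_comm (c z)]
        have h1 := (hcl y z).trans hyz
        have h2 := (hg (ψ k) z y).trans ((dist_comm _ _).trans_le hyz)
        linarith
    _ = 3 / ((k : ℝ) + 1) := by ring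
    _ ≤ ε := by
        rw [div_le_iff₀ hkpos]
        rw [div_lt_iff₀ hε] at hk2
        linarith

/-- Geodesics from `p` to points escaping to infinity subconverge to a ray. -/
theorem exists_subseq_isometry [ProperSpace H] (p : H) (x : ℕ → H) (g : ℕ → ℝ≥0 → H)
    (hg : ∀ n, IsStoppedGeodesic p (x n) (g n))
    (hx : Tendsto (fun n => nndist p (x n)) atTop atTop) :
    ∃ ψ : ℕ → ℕ, StrictMono ψ ∧ ∃ c : ℝ≥0 → H, Isometry c ∧
      TendstoLocallyUniformly (fun n => g (ψ n)) c atTop := by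
  obtain ⟨ψ, hψ, c, hc⟩ := exists_subseq_tendstoLocallyUniformly p g
    (fun n => (hg n).dist_le) (fun n => (hg n).map_zero)
  refine ⟨ψ, hψ, c, Isometry.of_dist_eq fun s t => ?_, hc⟩
  have hpt : ∀ u, Tendsto (fun n => g (ψ n) u) atTop (𝓝 (c u)) := fun u =>
    hc.tendstoLocallyUniformlyOn.tendsto_at (Set.mem_univ u)
  refine tendsto_nhds_unique ((hpt s).dist (hpt t)) (tendsto_const_nhds.congr' ?_)
  have hx' := hx.comp hψ.tendsto_atTop
  filter_upwards [hx'.eventually_ge_atTop s, hx'.eventually_ge_atTop t] with n hs ht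
  exact ((hg (ψ n)).dist_eq s hs t ht).symm

/-- The points of a ray, wherever it starts, converge to its endpoint as seen from any `p`. -/
theorem IsUniqueVisibilityGromovSpace.convergesFrom_ray (hH : IsUniqueVisibilityGromovSpace H)
    (p : H) (γ : GeodesicRay H) :
    ConvergesFrom p (fun n : ℕ => Sum.inl (γ.1 n)) (Sum.inr γ.endpoint) := by
  have := hH.proper
  obtain ⟨δ, hδ, hslim⟩ := hH.slim
  choose g hg using fun n : ℕ => hH.uniqueGeodesic.exists_isStoppedGeodesic p (γ.1 n)
  have hx : Tendsto (fun n : ℕ => nndist p (γ.1 n)) atTop atTop := by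
    have h1 : Tendsto (fun n : ℕ => (n : ℝ) - dist p (γ.1 0)) atTop atTop :=
      tendsto_atTop_add_const_right _ _ tendsto_natCast_atTop_atTop
    rw [← NNReal.tendsto_coe_atTop]
    refine tendsto_atTop_mono (fun n => ?_) h1
    have h2 := dist_zero_of_isometry γ.2 n
    have h3 := dist_triangle_left (γ.1 0) (γ.1 n) p
    rw [coe_nndist]
    push_cast at h2
    linarith
  refine ⟨g, fun n => ⟨(hg n).map_zero, nndist p (γ.1 n), (hg n).dist_eq, (hg n).eq_of_le⟩, ?_⟩
  intro φ hφ
  obtain ⟨ψ, hψ, c, hc, hlim⟩ := exists_subseq_isometry p (fun n => γ.1 (φ n : ℕ))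
    (fun n => g (φ n)) (fun n => hg (φ n)) (hx.comp hφ.tendsto_atTop)
  refine ⟨ψ, hψ, c, ⟨hc, Quotient.sound ⟨3 * dist p (γ.1 0) + 2 * δ, fun t => ?_⟩⟩, hlim⟩
  refine le_of_tendsto
    ((hlim.tendstoLocallyUniformlyOn.tendsto_at (Set.mem_univ t)).dist tendsto_const_nhds) ?_
  filter_upwards [((hx.comp hφ.tendsto_atTop).comp hψ.tendsto_atTop).eventually_ge_atTop t]
    with n hn
  set m := φ (ψ n)
  have ht : dist p (g m t) = t := (hg m).dist_left hn
  have hD := dist_nonneg (x := p) (y := γ.1 0)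
  obtain ⟨b, hb, hab⟩ := hslim p (γ.1 m) (γ.1 0) (g m t) ((hg m).mem_side t)
  rcases hb with hb | hb
  · obtain ⟨u, rfl⟩ := hH.uniqueGeodesic.exists_eq_of_mem_side γ.2 (mem_side_symm hb)
    have hu := dist_zero_of_isometry γ.2 u
    have hut : dist (γ.1 u) (γ.1 t) ≤ dist p (γ.1 0) + δ := by
      rw [γ.2.dist_eq, NNReal.dist_eq, abs_le]
      have h1 := dist_triangle4 (γ.1 0) p (g m t) (γ.1 u)
      have h2 := dist_triangle4 p (γ.1 0) (γ.1 u) (g m t)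
      rw [dist_comm (γ.1 0) p] at h1
      rw [dist_comm (γ.1 u) (g m t)] at h2
      constructor <;> linarith
    linarith [dist_triangle (g m t) (γ.1 u) (γ.1 t)]
  · have h1 := dist_add_dist_of_mem_side hb
    have h2 := dist_triangle_right p (g m t) b
    have h3 := dist_triangle4 (g m t) p (γ.1 0) (γ.1 t)
    have h4 := dist_zero_of_isometry γ.2 t
    rw [dist_comm (g m t) p] at h3
    linarith [dist_nonneg (x := b) (y := γ.1 0)]

theorem IsUniqueVisibilityGromovSpace.exists_ray_from (hH : IsUniqueVisibilityGromovSpace H)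
    (p : H) (ξ : GromovBoundary H) : ∃ γ : GeodesicRay H, γ.1 0 = p ∧ γ.endpoint = ξ := by
  obtain ⟨γ, rfl⟩ := Quotient.exists_rep ξ
  obtain ⟨c, hc, hsub⟩ := hH.convergesFrom_ray p γ
  obtain ⟨ψ, -, c', ⟨hiso, hend⟩, hlim⟩ := hsub id strictMono_id
  refine ⟨⟨c', hiso⟩, ?_, hend⟩
  refine tendsto_nhds_unique (hlim.tendstoLocallyUniformlyOn.tendsto_at (Set.mem_univ 0))
    (tendsto_const_nhds.congr fun n => ?_)
  exact (hc _).1.symm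

theorem IsUniqueVisibilityGromovSpace.isBounded_of_isEmpty
    (hH : IsUniqueVisibilityGromovSpace H) (hemp : IsEmpty (GromovBoundary H)) (p : H) :
    ∃ R : ℝ, ∀ h : H, dist h p ≤ R := by
  have := hH.proper
  by_contra! hcon
  choose x hx using fun n : ℕ => hcon n
  choose g hg using fun n : ℕ => hH.uniqueGeodesic.exists_isStoppedGeodesic p (x n)
  have hxt : Tendsto (fun n : ℕ => nndist p (x n)) atTop atTop := by
    rw [← NNReal.tendsto_coe_atTop]
    refine tendsto_atTop_mono (fun n => ?_) tendsto_natCast_atTop_atTop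
    rw [coe_nndist, dist_comm]
    exact (hx n).le
  obtain ⟨-, -, c, hc, -⟩ := exists_subseq_isometry p x g hg hxt
  exact hemp.false (GeodesicRay.endpoint ⟨c, hc⟩)

/-! ### Busemann functions -/

theorem IsBusemannFunction.tendsto_ray (hH : IsUniqueVisibilityGromovSpace H) {p : H}
    {γ : GeodesicRay H} {b : H → ℝ} (hb : IsBusemannFunction p γ.endpoint b) (h : H) :
    Tendsto (fun n : ℕ => dist (γ.1 n) h - dist (γ.1 n) p) atTop (𝓝 (b h)) :=
  hb h _ (hH.convergesFrom_ray p γ)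

theorem IsBusemannFunction.map_basepoint (hH : IsUniqueVisibilityGromovSpace H) {p : H}
    {ξ : GromovBoundary H} {b : H → ℝ} (hb : IsBusemannFunction p ξ b) : b p = 0 := by
  obtain ⟨γ, -, rfl⟩ := hH.exists_ray_from p ξ
  refine tendsto_nhds_unique (hb.tendsto_ray hH p) ?_
  simp

theorem IsBusemannFunction.abs_sub_le (hH : IsUniqueVisibilityGromovSpace H) {p : H}
    {ξ : GromovBoundary H} {b : H → ℝ} (hb : IsBusemannFunction p ξ b) (h h' : H) :
    |b h - b h'| ≤ dist h h' := by
  obtain ⟨γ, -, rfl⟩ := hH.exists_ray_from p ξ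
  refine le_of_tendsto ((hb.tendsto_ray hH h).sub (hb.tendsto_ray hH h')).abs
    (Eventually.of_forall fun n => ?_)
  rw [sub_sub_sub_cancel_right, dist_comm (γ.1 n), dist_comm (γ.1 n)]
  exact abs_dist_sub_le _ _ _

theorem endpoint_mapRay (g : H ≃ᵢ H) (γ : GeodesicRay H) :
    (mapRay g γ).endpoint = boundaryMap g γ.endpoint := rfl

/-- An isometry transports Busemann functions up to the change of base point. -/
theorem IsBusemannFunction.map_isometryEquiv (hH : IsUniqueVisibilityGromovSpace H) {p : H}
    {ξ : GromovBoundary H} {g : H ≃ᵢ H} {b b' : H → ℝ} (hb : IsBusemannFunction p ξ b)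
    (hb' : IsBusemannFunction p (boundaryMap g ξ) b') (h : H) :
    b' (g h) = b h - b (g.symm p) := by
  obtain ⟨γ, -, rfl⟩ := hH.exists_ray_from p ξ
  rw [← endpoint_mapRay] at hb'
  refine tendsto_nhds_unique (hb'.tendsto_ray hH (g h)) ?_
  refine ((hb.tendsto_ray hH h).sub (hb.tendsto_ray hH (g.symm p))).congr fun n => ?_
  have h1 : dist (g (γ.1 n)) (g h) = dist (γ.1 n) h := g.isometry.dist_eq _ _
  have h2 : dist (g (γ.1 n)) p = dist (γ.1 n) (g.symm p) := by
    rw [← g.isometry.dist_eq (γ.1 n), g.apply_symm_apply]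
  change _ = dist (g (γ.1 n)) (g h) - dist (g (γ.1 n)) p
  rw [h1, h2]
  ring

/-- Busemann functions are quasi-convex along geodesics issuing from the base point. -/
theorem IsBusemannFunction.le_of_mem_side (hH : IsUniqueVisibilityGromovSpace H) {δ : ℝ}
    (hslim : ∀ x y z : H, ∀ a ∈ side x y, ∃ b ∈ side y z ∪ side x z, dist a b ≤ δ) {p : H}
    {ξ : GromovBoundary H} {b : H → ℝ} (hb : IsBusemannFunction p ξ b) {h z : H} {M : ℝ}
    (hM : 0 ≤ M) (hbh : b h ≤ M) (hz : z ∈ side p h) : b z ≤ M + δ := by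
  obtain ⟨γ, -, rfl⟩ := hH.exists_ray_from p ξ
  have key : ∀ n : ℕ, dist (γ.1 n) z - dist (γ.1 n) p ≤
      max (dist (γ.1 n) h - dist (γ.1 n) p) 0 + δ := by
    intro n
    obtain ⟨w, hw, hzw⟩ := hslim p h (γ.1 n) z hz
    have h1 := dist_triangle_left (γ.1 n) z w
    rw [dist_comm w z, dist_comm w (γ.1 n)] at h1
    rcases hw with hw | hw
    · have h2 := dist_add_dist_of_mem_side hw
      rw [dist_comm w, dist_comm h (γ.1 n)] at h2
      linarith [le_max_left (dist (γ.1 n) h - dist (γ.1 n) p) 0, dist_nonneg (x := h) (y := w)]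
    · have h2 := dist_add_dist_of_mem_side hw
      rw [dist_comm w, dist_comm p (γ.1 n)] at h2
      linarith [le_max_right (dist (γ.1 n) h - dist (γ.1 n) p) 0, dist_nonneg (x := p) (y := w)]
  have hlim := ((hb.tendsto_ray hH h).max (tendsto_const_nhds (x := (0 : ℝ)))).add
    (tendsto_const_nhds (x := δ))
  have := le_of_tendsto_of_tendsto' (hb.tendsto_ray hH z) hlim key
  linarith [max_le hbh hM]

/-- Far from `p`, a point in a horoball at `γ(∞)` is seen from `p` in the direction of `γ`. -/
theorem IsBusemannFunction.dist_ray_le (hH : IsUniqueVisibilityGromovSpace H) {δ : ℝ}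
    (hslim : ∀ x y z : H, ∀ a ∈ side x y, ∃ b ∈ side y z ∪ side x z, dist a b ≤ δ)
    {γ : GeodesicRay H} {b : H → ℝ} (hb : IsBusemannFunction (γ.1 0) γ.endpoint b) {h z : H}
    {t₀ : ℝ≥0} (hz : z ∈ side (γ.1 0) h) (hzt : dist (γ.1 0) z = t₀)
    (hfar : b h < dist h (γ.1 0) - 2 * t₀ - 2 * δ) : dist z (γ.1 t₀) ≤ 2 * δ := by
  by_contra! hcon
  have key : ∀ n : ℕ, dist h (γ.1 0) - 2 * t₀ - 2 * δ ≤ dist (γ.1 n) h - dist (γ.1 n) (γ.1 0) := by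
    intro n
    obtain ⟨w, hw, hzw⟩ := hslim (γ.1 0) h (γ.1 n) z hz
    rcases hw with hw | hw
    · have h1 := dist_add_dist_of_mem_side hw
      have h2 := dist_triangle4 h w z (γ.1 0)
      have h3 := dist_triangle4 (γ.1 n) w z (γ.1 0)
      rw [dist_comm w z, dist_comm z (γ.1 0)] at h2 h3
      rw [dist_comm (γ.1 n) w] at h3
      rw [dist_comm (γ.1 n) h]
      linarith
    · exfalso
      obtain ⟨u, rfl⟩ := hH.uniqueGeodesic.exists_eq_of_mem_side γ.2 hw
      have hu := dist_zero_of_isometry γ.2 u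
      have hut : dist (γ.1 u) (γ.1 t₀) ≤ δ := by
        rw [γ.2.dist_eq, NNReal.dist_eq, abs_le]
        have h1 := dist_triangle (γ.1 0) z (γ.1 u)
        have h2 := dist_triangle_right (γ.1 0) z (γ.1 u)
        constructor <;> linarith
      linarith [dist_triangle z (γ.1 u) (γ.1 t₀)]
  linarith [ge_of_tendsto (hb.tendsto_ray hH h) (Eventually.of_forall key)]

/-- Horoballs with distinct centres have bounded intersection. -/
theorem IsBusemannFunction.bounded_inter (hH : IsUniqueVisibilityGromovSpace H) {p : H}
    {ξ η : GromovBoundary H} (hne : ξ ≠ η) {b b' : H → ℝ} (hb : IsBusemannFunction p ξ b)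
    (hb' : IsBusemannFunction p η b') (M : ℝ) :
    ∃ R : ℝ, ∀ h, b h ≤ M → b' h ≤ M → dist h p ≤ R := by
  obtain ⟨δ, hδ, hslim⟩ := hH.slim
  obtain ⟨γ, hγ, rfl⟩ := hH.exists_ray_from p ξ
  obtain ⟨γ', hγ', rfl⟩ := hH.exists_ray_from p η
  obtain ⟨t₀, ht₀⟩ : ∃ t, 4 * δ < dist (γ.1 t) (γ'.1 t) := by
    by_contra! hcon
    exact hne (Quotient.sound ⟨4 * δ, hcon⟩)
  refine ⟨max t₀ (M + 2 * t₀ + 2 * δ), fun h h1 h2 => ?_⟩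
  by_contra! hcon
  obtain ⟨hc1, hc2⟩ := max_lt_iff.1 hcon
  obtain ⟨g, hg⟩ := hH.uniqueGeodesic.exists_isStoppedGeodesic p h
  have hle : t₀ ≤ nndist p h := by
    rw [← NNReal.coe_le_coe, coe_nndist, dist_comm]
    exact hc1.le
  have hd := hg.dist_left hle
  have hs := hg.mem_side t₀
  have e1 : dist (g t₀) (γ.1 t₀) ≤ 2 * δ := by
    rw [← hγ] at hb hs hd
    refine hb.dist_ray_le hH hslim hs hd ?_
    rw [hγ]
    linarith
  have e2 : dist (g t₀) (γ'.1 t₀) ≤ 2 * δ := by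
    rw [← hγ'] at hb' hs hd
    refine hb'.dist_ray_le hH hslim hs hd ?_
    rw [hγ']
    linarith
  linarith [dist_triangle_left (γ.1 t₀) (γ'.1 t₀) (g t₀)]

/-- The bound for the intersection of two horoballs with distinct centres persists when the
Busemann functions vary continuously, uniformly on bounded sets. -/
theorem exists_nhds_bounded_inter {Ω : Type*} [TopologicalSpace Ω]
    (hH : IsUniqueVisibilityGromovSpace H) {p : H} {α β : Ω → GromovBoundary H}
    {b b' : Ω → H → ℝ} (hb : ∀ ω, IsBusemannFunction p (α ω) (b ω))
    (hb' : ∀ ω, IsBusemannFunction p (β ω) (b' ω)) {ω₁ : Ω} (hne : α ω₁ ≠ β ω₁)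
    (hc : ∀ R : ℝ, ∀ᶠ ω in 𝓝 ω₁, ∀ h ∈ Metric.closedBall p R, |b ω₁ h - b ω h| ≤ 1)
    (hc' : ∀ R : ℝ, ∀ᶠ ω in 𝓝 ω₁, ∀ h ∈ Metric.closedBall p R, |b' ω₁ h - b' ω h| ≤ 1)
    {M : ℝ} (hM : 0 ≤ M) :
    ∃ R : ℝ, ∀ᶠ ω in 𝓝 ω₁, ∀ h, b ω h ≤ M → b' ω h ≤ M → dist h p ≤ R := by
  obtain ⟨δ, hδ, hslim⟩ := hH.slim
  obtain ⟨R, hR⟩ := IsBusemannFunction.bounded_inter hH hne (hb ω₁) (hb' ω₁) (M + δ + 1)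
  have hR0 : 0 ≤ R := by
    have h1 := (hb ω₁).map_basepoint hH
    have h2 := (hb' ω₁).map_basepoint hH
    simpa using hR p (by linarith) (by linarith)
  refine ⟨R + 1, ?_⟩
  filter_upwards [hc (R + 1), hc' (R + 1)] with ω h1 h2 h hbh hbh'
  by_contra! hcon
  -- The point of `[p, h]` at distance `R + 1` from `p` would contradict the bound at `ω₁`.
  obtain ⟨g, hg⟩ := hH.uniqueGeodesic.exists_isStoppedGeodesic p h
  set t : ℝ≥0 := ⟨R + 1, by linarith⟩
  have hle : t ≤ nndist p h := by
    rw [← NNReal.coe_le_coe, coe_nndist, dist_comm]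
    exact hcon.le
  have hd : dist p (g t) = R + 1 := hg.dist_left hle
  have hmem : g t ∈ Metric.closedBall p (R + 1) := by
    rw [Metric.mem_closedBall, dist_comm, hd]
  have hs := hg.mem_side t
  have k1 := (hb ω).le_of_mem_side hH hslim hM hbh hs
  have k2 := (hb' ω).le_of_mem_side hH hslim hM hbh' hs
  have l1 := (abs_le.1 (h1 _ hmem)).2
  have l2 := (abs_le.1 (h2 _ hmem)).2
  have := hR (g t) (by linarith) (by linarith)
  rw [dist_comm, hd] at this
  linarith

end Geometry

/-! ### The closing property and Hölder sums -/

section Dynamics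

variable {Ω : Type*} [MetricSpace Ω]

theorem sum_pow_min_le {r : ℝ} (h0 : 0 ≤ r) (h1 : r < 1) (k : ℕ) :
    ∑ j ∈ Finset.range k, r ^ min j (k - j) ≤ 2 * (1 - r)⁻¹ := by
  have hgeom : ∀ n, ∑ j ∈ Finset.range n, r ^ j ≤ (1 - r)⁻¹ := fun n => by
    rw [← tsum_geometric_of_lt_one h0 h1]
    exact (summable_geometric_of_lt_one h0 h1).sum_le_tsum _ fun j _ => pow_nonneg h0 j
  have hrefl : ∑ j ∈ Finset.range k, r ^ (k - j) ≤ ∑ j ∈ Finset.range (k + 1), r ^ j := by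
    rw [← Finset.sum_range_reflect (fun j => r ^ j) (k + 1), Finset.sum_range_succ]
    simp only [Nat.add_sub_cancel]
    exact le_add_of_nonneg_right (pow_nonneg h0 _)
  have hmin : ∀ j ∈ Finset.range k, r ^ min j (k - j) ≤ r ^ j + r ^ (k - j) := fun j _ => by
    rcases min_choice j (k - j) with h | h <;> rw [h]
    · exact le_add_of_nonneg_right (pow_nonneg h0 _)
    · exact le_add_of_nonneg_left (pow_nonneg h0 _)
  calc _ ≤ ∑ j ∈ Finset.range k, (r ^ j + r ^ (k - j)) := Finset.sum_le_sum hmin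
    _ = ∑ j ∈ Finset.range k, r ^ j + ∑ j ∈ Finset.range k, r ^ (k - j) := Finset.sum_add_distrib
    _ ≤ (1 - r)⁻¹ + (1 - r)⁻¹ := add_le_add (hgeom k) (hrefl.trans (hgeom _))
    _ = _ := by ring

/-- An almost closed orbit segment is shadowed by a periodic one, with a total Hölder error
controlled by the size of the gap and independent of the length. -/
theorem ClosingProperty.exists_periodic_sum_le {T : Ω ≃ₜ Ω} (hT : ClosingProperty T) {τ : ℝ}
    (hτ : 0 < τ) :
    ∃ δ₀ S : ℝ, 0 < δ₀ ∧ 0 < S ∧ ∀ (x : Ω) (k : ℕ), dist x (T^[k] x) < δ₀ →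
      ∃ q : Ω, T^[k] q = q ∧
        ∑ j ∈ Finset.range k, dist (T^[j] x) (T^[j] q) ^ τ ≤ S * dist x (T^[k] x) ^ τ := by
  obtain ⟨c, lam, δ₀, hc, hlam, hδ₀, hcl⟩ := hT
  set r := Real.exp (-lam * τ) with hr
  have hr0 : 0 ≤ r := (Real.exp_pos _).le
  have hr1 : r < 1 := by
    rw [hr, Real.exp_lt_one_iff]
    nlinarith
  have hinv : 0 < (1 - r)⁻¹ := inv_pos.2 (by linarith)
  refine ⟨δ₀, c ^ τ * (2 * (1 - r)⁻¹), hδ₀, by positivity, fun x k hx => ?_⟩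
  obtain ⟨q, hq, hclose, -⟩ := hcl x k hx
  refine ⟨q, hq, ?_⟩
  set d := dist x (T^[k] x)
  have hd : 0 ≤ d := dist_nonneg
  calc ∑ j ∈ Finset.range k, dist (T^[j] x) (T^[j] q) ^ τ
      ≤ ∑ j ∈ Finset.range k, (c ^ τ * d ^ τ) * r ^ min j (k - j) := by
        refine Finset.sum_le_sum fun j hj => ?_
        refine (Real.rpow_le_rpow dist_nonneg (hclose j (Finset.mem_range.1 hj).le) hτ.le).trans ?_
        rw [Real.mul_rpow (by positivity) (Real.exp_pos _).le, Real.mul_rpow hc.le hd,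
          ← Real.exp_mul, hr, ← Real.exp_nat_mul]
        apply le_of_eq
        ring_nf
    _ = (c ^ τ * d ^ τ) * ∑ j ∈ Finset.range k, r ^ min j (k - j) := (Finset.mul_sum _ _ _).symm
    _ ≤ (c ^ τ * d ^ τ) * (2 * (1 - r)⁻¹) := by
        gcongr
        exact sum_pow_min_le hr0 hr1 k
    _ = _ := by ring

theorem exists_bound_of_locally_bounded [CompactSpace Ω] {ι : Type*} (x : ι → Ω) (f : ι → ℝ)
    (h : ∀ ω, ∃ R : ℝ, ∃ U ∈ 𝓝 ω, ∀ i, x i ∈ U → f i ≤ R) : ∃ R : ℝ, ∀ i, f i ≤ R := by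
  have : ∃ R : ℝ, ∀ i, x i ∈ (Set.univ : Set Ω) → f i ≤ R := by
    refine isCompact_univ.induction_on (p := fun s => ∃ R : ℝ, ∀ i, x i ∈ s → f i ≤ R)
      ⟨0, fun i hi => hi.elim⟩ ?_ ?_ ?_
    · rintro s t hst ⟨R, hR⟩
      exact ⟨R, fun i hi => hR i (hst hi)⟩
    · rintro s t ⟨R, hR⟩ ⟨R', hR'⟩
      exact ⟨max R R', fun i hi => hi.elim (fun h => (hR i h).trans (le_max_left _ _))
        fun h => (hR' i h).trans (le_max_right _ _)⟩
    · intro ω _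
      obtain ⟨R, U, hU, hR⟩ := h ω
      exact ⟨U, mem_nhdsWithin_of_mem_nhds hU, R, hR⟩
  obtain ⟨R, hR⟩ := this
  exact ⟨R, fun i => hR i trivial⟩

theorem zpow_add_natCast_apply (T : Ω ≃ₜ Ω) (ω : Ω) (m : ℤ) (k : ℕ) :
    (T ^ (m + k)) ω = T^[k] ((T ^ m) ω) := by
  induction k with
  | zero => simp
  | succ k ih =>
    rw [Function.iterate_succ_apply', ← ih, Nat.cast_succ, ← add_assoc, add_comm _ (1 : ℤ),
      zpow_one_add]
    rfl

/-- Real-valued Livšic argument: the Birkhoff sums, over an orbit, of a Hölder function without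
periodic obstruction are bounded. -/
theorem exists_bound_of_periodic_sum_eq_zero [CompactSpace Ω] {T : Ω ≃ₜ Ω}
    (hT : ClosingProperty T) {τ : ℝ} (hτ : 0 < τ) {t : Ω → ℝ} {C : ℝ} (hC : 0 ≤ C)
    (ht : ∀ ω ω', |t ω - t ω'| ≤ C * dist ω ω' ^ τ)
    (hper : ∀ (q : Ω) (k : ℕ), T^[k] q = q → ∑ j ∈ Finset.range k, t (T^[j] q) = 0)
    (ω₀ : Ω) (f : ℤ → ℝ) (hf : ∀ m, f (m + 1) = f m + t ((T ^ m) ω₀)) :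
    ∃ M : ℝ, ∀ m, |f m| ≤ M := by
  obtain ⟨δ₀, S, hδ₀, hS, hcl⟩ := hT.exists_periodic_sum_le hτ
  have hsum : ∀ (m : ℤ) (k : ℕ),
      f (m + k) = f m + ∑ j ∈ Finset.range k, t (T^[j] ((T ^ m) ω₀)) := by
    intro m k
    induction k with
    | zero => simp
    | succ k ih =>
      rw [Nat.cast_succ, ← add_assoc, hf, ih, Finset.sum_range_succ, zpow_add_natCast_apply]
      ring
  have hret : ∀ (m : ℤ) (k : ℕ), dist ((T ^ m) ω₀) ((T ^ (m + k)) ω₀) < δ₀ →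
      |f (m + k) - f m| ≤ C * (S * δ₀ ^ τ) := by
    intro m k hd
    rw [zpow_add_natCast_apply] at hd
    obtain ⟨q, hq, hle⟩ := hcl _ _ hd
    have e : f (m + k) - f m =
        ∑ j ∈ Finset.range k, (t (T^[j] ((T ^ m) ω₀)) - t (T^[j] q)) := by
      rw [Finset.sum_sub_distrib, hper q k hq, hsum]
      ring
    rw [e]
    calc _ ≤ ∑ j ∈ Finset.range k, |t (T^[j] ((T ^ m) ω₀)) - t (T^[j] q)| :=
          Finset.abs_sum_le_sum_abs _ _
      _ ≤ ∑ j ∈ Finset.range k, C * dist (T^[j] ((T ^ m) ω₀)) (T^[j] q) ^ τ :=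
          Finset.sum_le_sum fun j _ => ht _ _
      _ ≤ C * (S * dist ((T ^ m) ω₀) (T^[k] ((T ^ m) ω₀)) ^ τ) := by
          rw [← Finset.mul_sum]
          gcongr
      _ ≤ _ := by gcongr
  have hret' : ∀ m n : ℤ, dist ((T ^ m) ω₀) ((T ^ n) ω₀) < δ₀ →
      |f n - f m| ≤ C * (S * δ₀ ^ τ) := by
    intro m n hd
    rcases le_total m n with h | h
    · obtain ⟨k, rfl⟩ := Int.le.dest h
      exact hret m k hd
    · obtain ⟨k, rfl⟩ := Int.le.dest h
      rw [abs_sub_comm]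
      exact hret n k (by rwa [dist_comm])
  refine exists_bound_of_locally_bounded (fun m : ℤ => (T ^ m) ω₀) (fun m => |f m|) fun ω => ?_
  by_cases hne : ∃ m : ℤ, (T ^ m) ω₀ ∈ Metric.ball ω (δ₀ / 2)
  · obtain ⟨m, hm⟩ := hne
    refine ⟨|f m| + C * (S * δ₀ ^ τ), _, Metric.ball_mem_nhds ω (half_pos hδ₀), fun n hn => ?_⟩
    have hd : dist ((T ^ m) ω₀) ((T ^ n) ω₀) < δ₀ := by
      rw [Metric.mem_ball] at hm hn
      linarith [dist_triangle_right ((T ^ m) ω₀) ((T ^ n) ω₀) ω]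
    linarith [hret' m n hd, abs_sub_abs_le_abs_sub (f n) (f m)]
  · push Not at hne
    exact ⟨0, _, Metric.ball_mem_nhds ω (half_pos hδ₀), fun n hn => (hne n hn).elim⟩

end Dynamics

/-! ### The cocycle along a dense orbit -/

section Cocycles

variable {Ω : Type*} [MetricSpace Ω] {H : Type*} [MetricSpace H]

/-- The skew product `(ω, g) ↦ (T ω, A(ω) g)` on `Ω × Isom(H)`. -/
def skewIsom (T : Ω ≃ₜ Ω) (A : Ω → H ≃ᵢ H) : Equiv.Perm (Ω × (H ≃ᵢ H)) where
  toFun q := (T q.1, A q.1 * q.2)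
  invFun q := (T.symm q.1, (A (T.symm q.1))⁻¹ * q.2)
  left_inv q := by simp
  right_inv q := by simp

/-- The cocycle over the orbit of `ω₀`, for all integer times: it extends `A^n(ω₀)` to `n < 0`
by `A^{-n}(T^n ω₀)⁻¹`. -/
def orbitCocycle (T : Ω ≃ₜ Ω) (A : Ω → H ≃ᵢ H) (ω₀ : Ω) (m : ℤ) : H ≃ᵢ H :=
  ((skewIsom T A ^ m) (ω₀, 1)).2

theorem skewIsom_zpow_fst (T : Ω ≃ₜ Ω) (A : Ω → H ≃ᵢ H) (q : Ω × (H ≃ᵢ H)) (m : ℤ) :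
    ((skewIsom T A ^ m) q).1 = (T ^ m) q.1 := by
  induction m with
  | zero => simp
  | succ n ih =>
    rw [add_comm, zpow_one_add, zpow_one_add, Equiv.Perm.mul_apply]
    exact congrArg T ih
  | pred n ih =>
    rw [sub_eq_neg_add, zpow_add, zpow_add, zpow_neg_one, zpow_neg_one, Equiv.Perm.mul_apply]
    exact congrArg T.symm ih

theorem orbitCocycle_add_one (T : Ω ≃ₜ Ω) (A : Ω → H ≃ᵢ H) (ω₀ : Ω) (m : ℤ) :
    orbitCocycle T A ω₀ (m + 1) = A ((T ^ m) ω₀) * orbitCocycle T A ω₀ m := by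
  unfold orbitCocycle
  rw [add_comm, zpow_one_add, Equiv.Perm.mul_apply]
  have h := skewIsom_zpow_fst T A (ω₀, 1) m
  change A ((skewIsom T A ^ m) (ω₀, 1)).1 * _ = _
  rw [h]

theorem orbitCocycle_add_natCast (T : Ω ≃ₜ Ω) (A : Ω → H ≃ᵢ H) (ω₀ : Ω) (m : ℤ) (k : ℕ) :
    orbitCocycle T A ω₀ (m + k) = cocycleIter T A k ((T ^ m) ω₀) * orbitCocycle T A ω₀ m := by
  induction k with
  | zero => simp [cocycleIter]
  | succ k ih =>
    rw [Nat.cast_succ, ← add_assoc, orbitCocycle_add_one, ih, zpow_add_natCast_apply, cocycleIter,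
      mul_assoc]

theorem tendsto_const_mul_dist_rpow {τ : ℝ} (hτ : 0 < τ) (C : ℝ) (ω : Ω) :
    Tendsto (fun ω' => C * dist ω ω' ^ τ) (𝓝 ω) (𝓝 0) := by
  have : Continuous fun ω' => C * dist ω ω' ^ τ :=
    continuous_const.mul ((continuous_const.dist continuous_id).rpow_const fun _ => Or.inr hτ.le)
  simpa [hτ.ne'] using this.tendsto ω

theorem IsHolderCocycle.continuous {τ : ℝ} (hτ : 0 < τ) {A : Ω → H ≃ᵢ H}
    (hA : IsHolderCocycle τ A) (h : H) : Continuous fun ω => A ω h := by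
  obtain ⟨C, -, hC⟩ := hA {h} Bornology.isBounded_singleton
  refine continuous_iff_continuousAt.2 fun ω => tendsto_iff_dist_tendsto_zero.2 ?_
  refine squeeze_zero (fun _ => dist_nonneg) (fun ω' => ?_) (tendsto_const_mul_dist_rpow hτ C ω)
  rw [dist_comm]
  exact hC ω ω' h rfl

theorem IsHolderCocycle.exists_dist_symm_le [CompactSpace Ω] {τ : ℝ} (hτ : 0 < τ)
    {A : Ω → H ≃ᵢ H} (hA : IsHolderCocycle τ A) (p : H) :
    ∃ R : ℝ, ∀ ω, dist ((A ω).symm p) p ≤ R := by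
  obtain ⟨R, hR⟩ := (isCompact_range (hA.continuous hτ p)).isBounded.subset_closedBall p
  refine ⟨R, fun ω => ?_⟩
  rw [← (A ω).isometry.dist_eq, (A ω).apply_symm_apply, dist_comm]
  exact hR (Set.mem_range_self ω)

/-- The cocycle moves the base point boundedly in the direction of an invariant boundary
section, as measured by Busemann functions. -/
theorem exists_bound_busemann [CompactSpace Ω] (hH : IsUniqueVisibilityGromovSpace H)
    {T : Ω ≃ₜ Ω} (hT : ClosingProperty T) {A : Ω → H ≃ᵢ H} {p : H} {τ : ℝ} (hτ : 0 < τ)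
    (hA : IsHolderCocycle τ A) (hPPO : PPO T A) {α : Ω → GromovBoundary H}
    (hα : ∀ ω, boundaryMap (A ω) (α ω) = α (T ω)) {b : Ω → H → ℝ}
    (hb : ∀ ω, IsBusemannFunction p (α ω) (b ω))
    (hbH : ∀ K : Set H, Bornology.IsBounded K → ∃ D : ℝ, 0 < D ∧ ∀ ω₁ ω₂ : Ω, ∀ h ∈ K,
      |b ω₁ h - b ω₂ h| ≤ D * dist ω₁ ω₂ ^ τ) (ω₀ : Ω) :
    ∃ M : ℝ, ∀ m : ℤ, |b ((T ^ m) ω₀) (orbitCocycle T A ω₀ m p)| ≤ M := by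
  obtain ⟨R, hR⟩ := hA.exists_dist_symm_le hτ p
  obtain ⟨C, hC, hAC⟩ := hA _ (Metric.isBounded_closedBall (x := p) (r := R))
  obtain ⟨D, hD, hbD⟩ := hbH _ (Metric.isBounded_closedBall (x := p) (r := R))
  have htrans : ∀ ω h, b (T ω) (A ω h) = b ω h - b ω ((A ω).symm p) := fun ω h =>
    (hb ω).map_isometryEquiv hH (by rw [hα]; exact hb (T ω)) h
  have hiter : ∀ (q : Ω) (k : ℕ), b (T^[k] q) (cocycleIter T A k q p) =
      ∑ j ∈ Finset.range k, -b (T^[j] q) ((A (T^[j] q)).symm p) := by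
    intro q k
    induction k with
    | zero => simpa [cocycleIter] using (hb q).map_basepoint hH
    | succ k ih =>
      rw [Function.iterate_succ_apply', Finset.sum_range_succ, ← ih]
      exact htrans _ _
  refine exists_bound_of_periodic_sum_eq_zero hT hτ (t := fun ω => -b ω ((A ω).symm p))
    (C := D + C) (by positivity) (fun ω ω' => ?_) (fun q k hq => ?_) ω₀ _ (fun m => ?_)
  · set u := (A ω).symm p with hu
    have huR : u ∈ Metric.closedBall p R := hR ω
    have h1 := hbD ω ω' u huR
    have h2 : dist u ((A ω').symm p) ≤ C * dist ω ω' ^ τ := by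
      have h3 := hAC ω ω' u huR
      rw [hu, (A ω).apply_symm_apply, ← hu, dist_comm] at h3
      rwa [← (A ω').isometry.dist_eq, (A ω').apply_symm_apply]
    have h4 := ((hb ω').abs_sub_le hH u ((A ω').symm p)).trans h2
    have h5 := abs_sub_le (b ω u) (b ω' u) (b ω' ((A ω').symm p))
    rw [neg_sub_neg, abs_sub_comm, add_mul]
    linarith
  · rw [← hiter, hPPO q k hq, hq]
    exact (hb q).map_basepoint hH
  · rw [orbitCocycle_add_one, add_comm m 1, zpow_one_add]
    change b (T ((T ^ m) ω₀)) (A ((T ^ m) ω₀) (orbitCocycle T A ω₀ m p)) = _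
    rw [htrans]
    ring

/-- The cocycle along an orbit is bounded. -/
theorem exists_bound_orbitCocycle [CompactSpace Ω] (hH : IsUniqueVisibilityGromovSpace H)
    (hbd : ∀ ξ : GromovBoundary H, ∃ η : GromovBoundary H, η ≠ ξ)
    {T : Ω ≃ₜ Ω} (hT : ClosingProperty T) {A : Ω → H ≃ᵢ H} {p : H} {τ : ℝ} (hτ : 0 < τ)
    (hA : IsHolderCocycle τ A) (hPPO : PPO T A)
    {s : Ω → GromovBoundary H → Ω → GromovBoundary H}
    (hs : SolvesP3 T (fun ω => boundaryMap (A ω)) s)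
    (hsH : ∀ ω₀ α₀, IsHolderBusemann p τ (s ω₀ α₀)) (ω₀ : Ω) :
    ∃ R : ℝ, ∀ m : ℤ, dist (orbitCocycle T A ω₀ m p) p ≤ R := by
  rcases isEmpty_or_nonempty (GromovBoundary H) with hemp | ⟨⟨ξ⟩⟩
  · obtain ⟨R, hR⟩ := hH.isBounded_of_isEmpty hemp p
    exact ⟨R, fun m => hR _⟩
  obtain ⟨η, hη⟩ := hbd ξ
  refine exists_bound_of_locally_bounded (fun m : ℤ => (T ^ m) ω₀) _ fun ω₁ => ?_
  -- Sections through distinct points over `ω₁` may come together elsewhere, so the pair of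
  -- sections is chosen depending on `ω₁`.
  obtain ⟨b, hb, hbH⟩ := hsH ω₁ ξ
  obtain ⟨b', hb', hbH'⟩ := hsH ω₁ η
  obtain ⟨M, hM⟩ := exists_bound_busemann hH hT hτ hA hPPO
    (hs.isSection ω₁ ξ).invariant hb hbH ω₀
  obtain ⟨M', hM'⟩ := exists_bound_busemann hH hT hτ hA hPPO
    (hs.isSection ω₁ η).invariant hb' hbH' ω₀
  have hclose : ∀ {b : Ω → H → ℝ}, (∀ K : Set H, Bornology.IsBounded K → ∃ D : ℝ, 0 < D ∧
      ∀ ω₁ ω₂ : Ω, ∀ h ∈ K, |b ω₁ h - b ω₂ h| ≤ D * dist ω₁ ω₂ ^ τ) →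
      ∀ R : ℝ, ∀ᶠ ω in 𝓝 ω₁, ∀ h ∈ Metric.closedBall p R, |b ω₁ h - b ω h| ≤ 1 := by
    intro b hbH R
    obtain ⟨D, -, hD⟩ := hbH _ (Metric.isBounded_closedBall (x := p) (r := R))
    filter_upwards [(tendsto_const_mul_dist_rpow hτ D ω₁).eventually_le_const one_pos] with ω hω
    exact fun h hh => (hD ω₁ ω h hh).trans hω
  obtain ⟨R, hR⟩ := exists_nhds_bounded_inter hH hb hb'
    (by rw [(hs.isSection ω₁ ξ).passes, (hs.isSection ω₁ η).passes]; exact hη.symm)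
    (hclose hbH) (hclose hbH') (M := max M M')
    (((abs_nonneg _).trans (hM 0)).trans (le_max_left _ _))
  exact ⟨R, _, hR, fun m hm => hm _
    (((le_abs_self _).trans (hM m)).trans (le_max_left _ _))
    (((le_abs_self _).trans (hM' m)).trans (le_max_right _ _))⟩

/-- Comparison of the fibre orbits of `h` over `x` and over `q`. Only the orbit over `x` has to stay
in the set `K` where `A` is Hölder, because the cocycle over `q` acts by isometries. -/
theorem dist_cocycleIter_le {T : Ω ≃ₜ Ω} {A : Ω → H ≃ᵢ H} {K : Set H} {C τ : ℝ}
    (hC : ∀ ω₁ ω₂ : Ω, ∀ h ∈ K, dist (A ω₁ h) (A ω₂ h) ≤ C * dist ω₁ ω₂ ^ τ) (x q : Ω) (h : H)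
    (hK : ∀ j, cocycleIter T A j x h ∈ K) (k : ℕ) :
    dist (cocycleIter T A k x h) (cocycleIter T A k q h) ≤
      C * ∑ j ∈ Finset.range k, dist (T^[j] x) (T^[j] q) ^ τ := by
  induction k with
  | zero => simp [cocycleIter]
  | succ k ih =>
    rw [Finset.sum_range_succ, mul_add]
    change dist (A (T^[k] x) (cocycleIter T A k x h)) (A (T^[k] q) (cocycleIter T A k q h)) ≤ _
    have h1 := hC (T^[k] x) (T^[k] q) _ (hK k)
    have h2 := (A (T^[k] q)).isometry.dist_eq (cocycleIter T A k x h) (cocycleIter T A k q h)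
    linarith [dist_triangle (A (T^[k] x) (cocycleIter T A k x h))
      (A (T^[k] q) (cocycleIter T A k x h)) (A (T^[k] q) (cocycleIter T A k q h))]

/-- A bounded orbit cocycle without periodic obstruction is uniformly continuous along the orbit,
on bounded subsets of `H`. -/
theorem orbitCocycle_uniform {T : Ω ≃ₜ Ω} (hT : ClosingProperty T) {A : Ω → H ≃ᵢ H} {p : H}
    {τ : ℝ} (hτ : 0 < τ) (hA : IsHolderCocycle τ A) (hPPO : PPO T A) {ω₀ : Ω} {R : ℝ}
    (hR : ∀ m : ℤ, dist (orbitCocycle T A ω₀ m p) p ≤ R) (r : ℝ) {ε : ℝ} (hε : 0 < ε) :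
    ∃ δ > 0, ∀ m n : ℤ, dist ((T ^ m) ω₀) ((T ^ n) ω₀) < δ → ∀ h, dist h p ≤ r →
      dist (orbitCocycle T A ω₀ m h) (orbitCocycle T A ω₀ n h) < ε := by
  obtain ⟨δ₀, S, hδ₀, hS, hcl⟩ := hT.exists_periodic_sum_le hτ
  obtain ⟨C, hC, hAC⟩ := hA _ (Metric.isBounded_closedBall (x := p) (r := r + R))
  have hlim : Tendsto (fun d : ℝ => C * (S * d ^ τ)) (𝓝 0) (𝓝 0) := by
    have : Continuous fun d : ℝ => C * (S * d ^ τ) :=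
      continuous_const.mul (continuous_const.mul (continuous_id.rpow_const fun _ => Or.inr hτ.le))
    simpa [hτ.ne'] using this.tendsto 0
  obtain ⟨δ₁, hδ₁, hball⟩ := Metric.eventually_nhds_iff.1 (hlim.eventually_lt_const hε)
  have hret : ∀ (m : ℤ) (k : ℕ), dist ((T ^ m) ω₀) ((T ^ (m + k)) ω₀) < min δ₀ δ₁ →
      ∀ h, dist h p ≤ r →
      dist (orbitCocycle T A ω₀ (m + k) h) (orbitCocycle T A ω₀ m h) < ε := by
    intro m k hd h hh
    rw [zpow_add_natCast_apply] at hd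
    obtain ⟨q, hq, hle⟩ := hcl _ _ (hd.trans_le (min_le_left _ _))
    have hbdd : ∀ j, cocycleIter T A j ((T ^ m) ω₀) (orbitCocycle T A ω₀ m h) ∈
        Metric.closedBall p (r + R) := by
      intro j
      have e := congrArg (fun g : H ≃ᵢ H => g h) (orbitCocycle_add_natCast T A ω₀ m j)
      change _ = cocycleIter T A j ((T ^ m) ω₀) (orbitCocycle T A ω₀ m h) at e
      rw [← e, Metric.mem_closedBall]
      have h1 := (orbitCocycle T A ω₀ (m + j)).isometry.dist_eq h p
      linarith [dist_triangle (orbitCocycle T A ω₀ (m + j) h) (orbitCocycle T A ω₀ (m + j) p) p,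
        hR (m + j)]
    have h1 := dist_cocycleIter_le hAC ((T ^ m) ω₀) q (orbitCocycle T A ω₀ m h) hbdd k
    rw [hPPO q k hq] at h1
    rw [orbitCocycle_add_natCast]
    refine (h1.trans (mul_le_mul_of_nonneg_left hle hC.le)).trans_lt (hball ?_)
    rw [Real.dist_eq, sub_zero, abs_of_nonneg dist_nonneg]
    exact hd.trans_le (min_le_right _ _)
  refine ⟨min δ₀ δ₁, lt_min hδ₀ hδ₁, fun m n hd h hh => ?_⟩
  rcases le_total m n with hmn | hmn
  · obtain ⟨k, rfl⟩ := Int.le.dest hmn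
    rw [dist_comm]
    exact hret m k hd h hh
  · obtain ⟨k, rfl⟩ := Int.le.dest hmn
    exact hret n k (by rwa [dist_comm]) h hh

/-! ### Extension from the dense orbit -/

theorem exists_continuous_extension [CompleteSpace H] {ι : Type*} {x : ι → Ω}
    (hx : DenseRange x) (u : ι → H)
    (hu : ∀ ε > 0, ∃ δ > 0, ∀ i j, dist (x i) (x j) < δ → dist (u i) (u j) < ε) :
    ∃ v : Ω → H, Continuous v ∧ ∀ i, v (x i) = u i := by
  let _ : PseudoMetricSpace ι := PseudoMetricSpace.induced x inferInstance
  have hind : IsUniformInducing x := ⟨rfl⟩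
  have huc : UniformContinuous u := by
    rw [Metric.uniformContinuous_iff]
    intro ε hε
    obtain ⟨δ, hδ, h⟩ := hu ε hε
    exact ⟨δ, hδ, fun {i j} => h i j⟩
  exact ⟨_, (uniformContinuous_uniformly_extend hind hx huc).continuous,
    uniformly_extend_of_ind hind hx huc⟩

theorem continuous_isometry_apply {f : Ω → H → H} (hf : ∀ ω, Isometry (f ω))
    (hc : ∀ h, Continuous fun ω => f ω h) {v : Ω → H} (hv : Continuous v) :
    Continuous fun ω => f ω (v ω) := by
  refine continuous_iff_continuousAt.2 fun ω => tendsto_iff_dist_tendsto_zero.2 ?_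
  have h1 := (tendsto_iff_dist_tendsto_zero.1 (hv.tendsto ω)).add
    (tendsto_iff_dist_tendsto_zero.1 ((hc (v ω)).tendsto ω))
  rw [add_zero] at h1
  refine squeeze_zero (fun _ => dist_nonneg) (fun ω' => ?_) h1
  rw [← (hf ω').dist_eq (v ω') (v ω)]
  exact dist_triangle _ _ _

/-- A family of isometries over a dense set extends continuously when it and the family of the
inverses are pointwise uniformly continuous. -/
theorem exists_isometryEquiv_extension [CompleteSpace H] {ι : Type*} {x : ι → Ω}
    (hx : DenseRange x) (B : ι → H ≃ᵢ H)
    (hB : ∀ h, ∀ ε > 0, ∃ δ > 0, ∀ i j, dist (x i) (x j) < δ → dist (B i h) (B j h) < ε)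
    (hB' : ∀ h, ∀ ε > 0, ∃ δ > 0, ∀ i j, dist (x i) (x j) < δ →
      dist ((B i).symm h) ((B j).symm h) < ε) :
    ∃ E : Ω → H ≃ᵢ H, (∀ h, Continuous fun ω => E ω h) ∧ ∀ i, E (x i) = B i := by
  choose f hf hfx using fun h => exists_continuous_extension hx (fun i => B i h) (hB h)
  choose f' hf' hfx' using fun h => exists_continuous_extension hx (fun i => (B i).symm h) (hB' h)
  have hiso : ∀ ω, Isometry fun h => f h ω := fun ω => Isometry.of_dist_eq fun h₁ h₂ => by
    refine congrFun (hx.equalizer ((hf h₁).dist (hf h₂)) continuous_const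
      (h := fun _ => dist h₁ h₂) (funext fun i => ?_)) ω
    simp only [Function.comp, hfx, (B i).isometry.dist_eq]
  have hiso' : ∀ ω, Isometry fun h => f' h ω := fun ω => Isometry.of_dist_eq fun h₁ h₂ => by
    refine congrFun (hx.equalizer ((hf' h₁).dist (hf' h₂)) continuous_const
      (h := fun _ => dist h₁ h₂) (funext fun i => ?_)) ω
    simp only [Function.comp, hfx', (B i).symm.isometry.dist_eq]
  have hl : ∀ ω h, f' (f h ω) ω = h := fun ω h =>
    congrFun (hx.equalizer (continuous_isometry_apply hiso' hf' (hf h)) continuous_const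
      (h := fun _ => h) (funext fun i => by simp [hfx, hfx'])) ω
  have hr : ∀ ω h, f (f' h ω) ω = h := fun ω h =>
    congrFun (hx.equalizer (continuous_isometry_apply hiso hf (hf' h)) continuous_const
      (h := fun _ => h) (funext fun i => by simp [hfx, hfx'])) ω
  refine ⟨fun ω => ⟨⟨fun h => f h ω, fun h => f' h ω, hl ω, hr ω⟩, hiso ω⟩, hf, fun i => ?_⟩
  ext h
  exact hfx h i

/-! ### Solving the three problems -/

/-- A bounded cocycle along a dense orbit gives a solution of the cohomological equation. -/
theorem P1_of_bounded [CompleteSpace H] {T : Ω ≃ₜ Ω} (hT : ClosingProperty T) {A : Ω → H ≃ᵢ H}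
    {p : H} {τ : ℝ} (hτ : 0 < τ) (hA : IsHolderCocycle τ A) (hPPO : PPO T A) {ω₀ : Ω}
    (hω₀ : Dense (Set.range fun n : ℤ => (T ^ n) ω₀)) {R : ℝ}
    (hR : ∀ m : ℤ, dist (orbitCocycle T A ω₀ m p) p ≤ R) : P1 T A := by
  set B := orbitCocycle T A ω₀
  have hx : DenseRange fun n : ℤ => (T ^ n) ω₀ := hω₀
  obtain ⟨E, hE, hEx⟩ := exists_isometryEquiv_extension hx B (fun h ε hε => by
      obtain ⟨δ, hδ, hd⟩ := orbitCocycle_uniform hT hτ hA hPPO hR (dist h p) hε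
      exact ⟨δ, hδ, fun m n hmn => hd m n hmn h le_rfl⟩) (fun h ε hε => by
      obtain ⟨δ, hδ, hd⟩ := orbitCocycle_uniform hT hτ hA hPPO hR (dist h p + R) hε
      refine ⟨δ, hδ, fun m n hmn => ?_⟩
      have hle : dist ((B m).symm h) p ≤ dist h p + R := by
        rw [← (B m).isometry.dist_eq, (B m).apply_symm_apply]
        exact (dist_triangle_right _ _ p).trans (add_le_add le_rfl (hR m))
      have h1 := hd m n hmn _ hle
      rwa [← (B n).isometry.dist_eq, (B n).apply_symm_apply, dist_comm,
        ← (B m).apply_symm_apply h, (B m).symm_apply_apply])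
  refine ⟨E, hE, fun ω => ?_⟩
  rw [mul_inv_eq_iff_eq_mul]
  ext h
  refine congrFun (hx.equalizer ((hE h).comp T.continuous)
    (continuous_isometry_apply (fun ω => (A ω).isometry) (hA.continuous hτ) (hE h))
    (funext fun m => ?_)) ω
  have hTm : T ((T ^ m) ω₀) = (T ^ (m + 1)) ω₀ := by
    rw [add_comm, zpow_one_add]
    rfl
  simp only [Function.comp, hTm, hEx]
  exact congrArg (fun g : H ≃ᵢ H => g h) (orbitCocycle_add_one T A ω₀ m)

theorem apply_eq_of_mul_inv_eq {T : Ω ≃ₜ Ω} {A B : Ω → H ≃ᵢ H}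
    (hB : ∀ ω, B (T ω) * (B ω)⁻¹ = A ω) (ω : Ω) (h : H) : A ω (B ω h) = B (T ω) h := by
  rw [← hB ω]
  exact congrArg (B (T ω)) ((B ω).symm_apply_apply h)

theorem P1.p2 {T : Ω ≃ₜ Ω} {A : Ω → H ≃ᵢ H} (h : P1 T A) : P2 T A := by
  obtain ⟨B, hBc, hB⟩ := h
  refine ⟨fun ω => (B ω).toHomeomorph, hBc, ?_⟩
  funext q
  rw [Function.comp_apply, Function.comp_apply, Equiv.symm_apply_eq]
  exact Prod.ext rfl (apply_eq_of_mul_inv_eq hB q.1 q.2)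

theorem P1.p3 {T : Ω ≃ₜ Ω} {A : Ω → H ≃ᵢ H} (h : P1 T A) : P3 T A := by
  obtain ⟨B, hBc, hB⟩ := h
  refine ⟨fun ω₀ x₀ ω => B ω ((B ω₀).symm x₀), fun ω₀ x₀ => ⟨hBc _, ?_, fun ω => ?_⟩,
    fun ω₀ ω => (B ω).continuous.comp (B ω₀).symm.continuous⟩
  · exact (B ω₀).apply_symm_apply x₀
  · exact apply_eq_of_mul_inv_eq hB ω _

end Cocycles

end LivsicIsom

theorem theorem5p3 {Ω : Type*} [MetricSpace Ω] [CompactSpace Ω]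
    {H : Type*} [MetricSpace H] (hH : IsUniqueVisibilityGromovSpace H)
    (hbd : ∀ ξ : GromovBoundary H, ∃ η : GromovBoundary H, η ≠ ξ)
    (T : Ω ≃ₜ Ω) (A : Ω → H ≃ᵢ H) (p : H) (τ : ℝ) (hτ : 0 < τ)
    (hT : IsHyperbolic T)
    (hA : IsHolderCocycle τ A)
    (hPPO : PPO T A)
    (hboundary : ∃ s : Ω → GromovBoundary H → Ω → GromovBoundary H,
      SolvesP3 T (fun ω => boundaryMap (A ω)) s ∧
        ∀ ω₀ α₀, IsHolderBusemann p τ (s ω₀ α₀)) :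
    P3 T A ∧ P2 T A ∧ P1 T A := by
  have := hH.proper
  obtain ⟨⟨ω₀, hω₀⟩, hcl⟩ := hT
  obtain ⟨s, hs, hsH⟩ := hboundary
  obtain ⟨R, hR⟩ := exists_bound_orbitCocycle hH hbd hcl hτ hA hPPO hs hsH ω₀
  have h1 : P1 T A := P1_of_bounded hcl hτ hA hPPO hω₀ hR
  exact ⟨h1.p3, h1.p2, h1⟩
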